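/- **Setting.** Let $N$ be a finite nonempty set of bidders, named by distinct identifiers in $\mathbb N$, and let $\mathcal F$ be a matroid on $N$, whose independent sets are the sets of bidders that can be served together. Bidder $i$ has a private value $v_i\ge 0$ drawn independently from a distribution $D_i$ with distribution function $F_i$ and density $f_i$, and places the truthful bid $v_i$. The virtual value is $\varphi_i(v)=v-\frac{1-F_i(v)}{f_i(v)}$ (read as $-\infty$ if $f_i(v)=0$ and $F_i(v)<1$, and as $v$ if $F_i(v)=1$). The distribution $D_i$ is *regular* if $\varphi_i$ is nondecreasing on $[0,\infty)$, and *MHR* if $\varphi_i(w)-\varphi_i(v)\ge w-v$ for all $w\ge v\ge 0$ (that is, $\varphi_i(v)+(w-v)\le\varphi_i(w)$). Its *monopoly reserve* is $r_i=\sup\{v\ge 0:\varphi_i(v)<0\}$. **The Deferred-Revelation Auction (DRA) over a public ledger with collateral $f$.** The auctioneer's (deterministic) plan $\pi$ consists of: a finite set $K$ of fabricated identifiers disjoint from $N$, with a fabricated bid $b_k\ge 0$ for each $k\in K$; a reported matroid $\hat{\mathcal F}$ on $N\cup K$; a reported regular distribution $\hat D_i$, with virtual value $\hat\varphi_i$,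 for each $i\in N\cup K$; and a measurable rule assigning to each vector $v$ of real bids a set $C(v)\subseteq K$ of fabricated bids to conceal. All other bids are revealed. The smart contract allocates the set $S\in\hat{\mathcal F}$ of revealed bidders that maximizes $\sum_{i\in S}\hat\varphi_i(\text{bid}_i)$, with ties broken lexicographically (at the smallest identifier at which two maximizers differ, the one that contains it is preferred). Each allocated bidder is charged its critical bid: the infimum of the bids $t\ge 0$ with which it is allocated, the other revealed bids being fixed. The auctioneer receives the payments of the allocated real bidders and loses $f$ for each concealed bid. A plan is admissible if, for every vector of nonnegative real bids, the set of allocated real bidders belongs to $\mathcal F$. The *honest* plan fabricates (and so conceals) no bid and reports the true distributions and the true matroid: $K=\emptyset$, $\hat D_i=D_i$, $\hat{\mathcal F}=\mathcal F$. The DRA with collateral $f$ is *credible* if the honest plan is admissible, every admissible plan has a well-defined (integrable) revenue, and the honest plan maximizes the expected revenue (over $v\sim\prod_{i\in N}D_i$) among all admissible plans. **Theorem.** For every matroid $\mathcal F$ on $N$ and all MHR distributions $D_i$ $(i\in N)$ with monopoly reserves $r_i$, the DRA over a public ledger with collateral $f=\max_{i\in N} r_i$ is credible. -/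

import Mathlib

open MeasureTheory
open scoped NNReal ENNReal

noncomputable section

namespace DRA

/-! ## Value distributions -/

/-- A distribution of values on the nonnegative reals, given by a probability density. -/
structure ValueDist where
  /-- the density function -/
  density : ℝ → ℝ≥0
  measurable_density : Measurable density
  density_of_neg : ∀ v, v < 0 → density v = 0
  lintegral_density : ∫⁻ v, (density v : ℝ≥0∞) = 1

/-- The law of a random value with the given density. -/
def ValueDist.law (D : ValueDist) : Measure ℝ :=
  volume.withDensity fun v => (D.density v : ℝ≥0∞)

instance (D : ValueDist) : IsProbabilityMeasure D.law :=
  ⟨by simp [ValueDist.law, D.lintegral_density]⟩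

/-- The virtual value `φ(v) = v - (1 - F(v)) / f(v)`, where `1 - F(v)` is the probability of a
value exceeding `v`. It is extended-real valued: where the density vanishes, the quotient is `∞`
(and `φ(v) = -∞`) if larger values are still possible, and the quotient is `0` (and `φ(v) = v`)
if `F(v) = 1`. -/
def ValueDist.virtualValue (D : ValueDist) (v : ℝ) : EReal :=
  (v : EReal) - ((D.law (Set.Ioi v) / (D.density v : ℝ≥0∞) : ℝ≥0∞) : EReal)

/-- `α`-strong regularity: `φ(w) - φ(v) ≥ α (w - v)` for all values `w ≥ v ≥ 0`. -/
def ValueDist.StronglyRegular (α : ℝ) (D : ValueDist) : Prop :=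
  ∀ v w : ℝ, 0 ≤ v → v ≤ w →
    D.virtualValue v + ((α * (w - v) : ℝ) : EReal) ≤ D.virtualValue w

/-- Regular: the virtual value is nondecreasing. -/
def ValueDist.Regular (D : ValueDist) : Prop := D.StronglyRegular 0

/-- Monotone hazard rate: `1`-strongly regular. -/
def ValueDist.MHR (D : ValueDist) : Prop := D.StronglyRegular 1

/-- The monopoly reserve of a regular distribution: the supremum of the values at which the
virtual value is negative. -/
def ValueDist.reserve (D : ValueDist) : ℝ :=
  sSup {v : ℝ | 0 ≤ v ∧ D.virtualValue v < 0}

/-! ## The mechanism run by the smart contract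

Bidders are named by identifiers in `ℕ`. -/

/-- `S` may be allocated under the feasibility constraint `M` when the bids of `R` are revealed. -/
def IsFeasible (M : Matroid ℕ) (R S : Finset ℕ) : Prop :=
  S ⊆ R ∧ M.Indep (S : Set ℕ)

/-- Lexicographic priority: at the first identifier at which `S` and `T` differ, it is `S` that
allocates. -/
def Precedes (S T : Finset ℕ) : Prop :=
  ∃ i ∈ S, i ∉ T ∧ ∀ j < i, (j ∈ S ↔ j ∈ T)

/-- `S` is a feasible set of maximal surplus for the weights `w`, and it comes first
lexicographically among all these. -/
def IsAllocation (M : Matroid ℕ) (R : Finset ℕ) (w : ℕ → EReal) (S : Finset ℕ) : Prop :=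
  IsFeasible M R S ∧
    ∀ T, IsFeasible M R T → T ≠ S →
      ∑ i ∈ T, w i < ∑ i ∈ S, w i ∨ (∑ i ∈ T, w i = ∑ i ∈ S, w i ∧ Precedes S T)

theorem precedes_asymm {S T : Finset ℕ} (h : Precedes S T) : ¬ Precedes T S := by
  rintro ⟨j, hjT, hjS, hj⟩
  obtain ⟨i, hiS, hiT, hi⟩ := h
  rcases lt_trichotomy i j with h | h | h
  · exact hiT ((hj i h).2 hiS)
  · subst h; exact hiT hjT
  · exact hjS ((hi j h).2 hjT)

theorem existsUnique_isAllocation (M : Matroid ℕ) (R : Finset ℕ) (w : ℕ → EReal) :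
    ∃! S, IsAllocation M R w S := by
  classical
  let A : Finset (Finset ℕ) := {S ∈ R.powerset | M.Indep (S : Set ℕ)}
  have hA : ∀ S, S ∈ A ↔ IsFeasible M R S := fun S => by simp [A, IsFeasible]
  obtain ⟨S₀, hS₀, hmax⟩ := A.exists_max_image (fun S => ∑ i ∈ S, w i)
    ⟨∅, by simp [hA, IsFeasible]⟩
  let B : Finset (Finset ℕ) := {S ∈ A | ∑ i ∈ S, w i = ∑ i ∈ S₀, w i}
  obtain ⟨S, hS, hlex⟩ := B.exists_max_image
    (fun S => toColex (S.map OrderDual.toDual.toEmbedding)) ⟨S₀, by simp [B, hS₀]⟩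
  have hS' : S ∈ A ∧ ∑ i ∈ S, w i = ∑ i ∈ S₀, w i := by simpa [B] using hS
  have key : IsAllocation M R w S := by
    refine ⟨(hA S).1 hS'.1, fun T hT hne => ?_⟩
    have hTA := (hA T).2 hT
    rcases (hmax T hTA).lt_or_eq with h | h
    · left; rwa [hS'.2]
    · right
      refine ⟨h.trans hS'.2.symm, ?_⟩
      have hlt := lt_of_le_of_ne (hlex T (by simp [B, hTA, h])) (fun he => hne (by
        simpa using he))
      obtain ⟨a, haS, haT, hb⟩ := Finset.Colex.toColex_lt_toColex_iff_exists_forall_lt.1 hlt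
      -- the largest element of the symmetric difference for the reversed order
      obtain ⟨i, hi, hmin⟩ := Finset.exists_min_image (symmDiff S T) id
        ⟨OrderDual.ofDual a, by
          simp only [Finset.mem_map_equiv] at haS haT
          exact Finset.mem_symmDiff.2 (Or.inl ⟨haS, haT⟩)⟩
      have heq : ∀ j < i, (j ∈ S ↔ j ∈ T) := by
        intro j hj
        by_contra hcon
        have : j ∈ symmDiff S T := by rw [Finset.mem_symmDiff]; tauto
        exact absurd (hmin j this) (by simpa using hj)
      rcases Finset.mem_symmDiff.1 hi with h1 | h1
      · exact ⟨i, h1.1, h1.2, heq⟩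
      · exfalso
        have hlt2 := hb (OrderDual.toDual i) (by simpa using h1.1) (by simpa using h1.2)
        have h3 : OrderDual.ofDual a < i := hlt2
        have h4 := heq _ h3
        simp only [Finset.mem_map_equiv] at haS haT
        exact haT (h4.1 haS)
  refine ⟨S, key, fun T hT => ?_⟩
  by_contra hne
  rcases key.2 T hT.1 hne with h | ⟨h, hp⟩
  · rcases hT.2 S key.1 (Ne.symm hne) with h' | ⟨h', -⟩
    · exact lt_asymm h h'
    · exact h.ne h'.symm
  · rcases hT.2 S key.1 (Ne.symm hne) with h' | ⟨-, hp'⟩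
    · exact h'.ne h.symm
    · exact precedes_asymm hp hp'

/-- The surplus-maximizing feasible subset of `R`, ties being broken lexicographically. -/
def allocation (M : Matroid ℕ) (R : Finset ℕ) (w : ℕ → EReal) : Finset ℕ :=
  (existsUnique_isAllocation M R w).choose

theorem isAllocation_allocation (M : Matroid ℕ) (R : Finset ℕ) (w : ℕ → EReal) :
    IsAllocation M R w (allocation M R w) :=
  (existsUnique_isAllocation M R w).choose_spec.1

/-- The set allocated by the smart contract for the matroid `M` and the distributions `D`, when
`R` is the set of identifiers whose bids are revealed and `b` is the vector of bids. -/
def winners (M : Matroid ℕ) (D : ℕ → ValueDist) (R : Finset ℕ) (b : ℕ → ℝ) : Finset ℕ :=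
  allocation M R fun i => (D i).virtualValue (b i)

/-- The critical bid of bidder `i`: the infimum of the bids with which `i` is allocated, given the
other revealed bids. -/
def criticalBid (M : Matroid ℕ) (D : ℕ → ValueDist) (R : Finset ℕ) (b : ℕ → ℝ) (i : ℕ) : ℝ :=
  sInf {t : ℝ | 0 ≤ t ∧ i ∈ winners M D R (Function.update b i t)}

/-! ## The auctioneer -/

/-- A (deterministic) plan of the auctioneer facing the real bidders `N`. -/
structure Plan (N : Finset ℕ) where
  /-- identifiers of the fabricated bids -/
  fakes : Finset ℕ
  /-- the fabricated bids (only the values on `fakes` matter) -/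
  fakeBid : ℕ → ℝ
  /-- the feasibility constraint reported to the ledger -/
  matroid : Matroid ℕ
  /-- the distributions reported to the ledger (only those on `N ∪ fakes` matter) -/
  report : ℕ → ValueDist
  /-- the fabricated bids concealed in the revelation phase, as a function of the real bids -/
  conceal : (N → ℝ) → Finset ℕ

namespace Plan

variable {N : Finset ℕ}

/-- The vector of all committed bids, when the real bids are `v`. -/
def bids (π : Plan N) (v : N → ℝ) : ℕ → ℝ :=
  fun i => if h : i ∈ N then v ⟨i, h⟩ else π.fakeBid i

/-- The identifiers whose bids get revealed. -/
def revealed (π : Plan N) (v : N → ℝ) : Finset ℕ :=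
  (N ∪ π.fakes) \ π.conceal v

/-- The real bidders that end up allocated. -/
def realWinners (π : Plan N) (v : N → ℝ) : Finset ℕ :=
  winners π.matroid π.report (π.revealed v) (π.bids v) ∩ N

/-- The auctioneer's revenue with collateral `f`: the payments of the allocated real bidders,
minus `f` for each concealed bid. -/
def revenue (π : Plan N) (f : ℝ) (v : N → ℝ) : ℝ :=
  ∑ i ∈ π.realWinners v, criticalBid π.matroid π.report (π.revealed v) (π.bids v) i
    - f * (π.conceal v).card

/-- The plans open to an auctioneer with true feasibility constraint `M`: finitely many
nonnegative bids are fabricated under unused identifiers, some matroid on all committed bids and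
regular distributions are reported, only fabricated bids are concealed, and the allocated real
bidders always form a feasible set. -/
structure Admissible (π : Plan N) (M : Matroid ℕ) : Prop where
  disjoint : Disjoint N π.fakes
  fakeBid_nonneg : ∀ i ∈ π.fakes, 0 ≤ π.fakeBid i
  ground : π.matroid.E = ((N ∪ π.fakes : Finset ℕ) : Set ℕ)
  report_regular : ∀ i ∈ N ∪ π.fakes, (π.report i).Regular
  conceal_subset : ∀ v, π.conceal v ⊆ π.fakes
  measurable_conceal : ∀ C : Finset ℕ, MeasurableSet {v | π.conceal v = C}
  feasible : ∀ v : N → ℝ, (∀ i, 0 ≤ v i) → M.Indep (π.realWinners v : Set ℕ)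

end Plan

/-- The honest plan: no bid is fabricated (hence none concealed), and the true matroid and the
true distributions are reported. -/
def honest (N : Finset ℕ) (M : Matroid ℕ) (D : ℕ → ValueDist) : Plan N where
  fakes := ∅
  fakeBid := fun _ => 0
  matroid := M
  report := D
  conceal := fun _ => ∅

/-- The joint law of the independent values of the real bidders. -/
def valuesLaw (N : Finset ℕ) (D : ℕ → ValueDist) : Measure (N → ℝ) :=
  Measure.pi fun i : N => (D i).law

/-- The deferred-revelation auction over a public ledger, with real bidders `N`, feasibility
constraint `M`, value distributions `D` and collateral `f`, is credible: being honest is open to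
the auctioneer and maximizes its expected revenue among all admissible plans, given that the real
bidders bid truthfully. (Expected revenues are required to exist.) -/
def Credible (N : Finset ℕ) (M : Matroid ℕ) (D : ℕ → ValueDist) (f : ℝ) : Prop :=
  (honest N M D).Admissible M ∧
  ∀ π : Plan N, π.Admissible M →
    Integrable (π.revenue f) (valuesLaw N D) ∧
    ∫ v, π.revenue f v ∂(valuesLaw N D) ≤ ∫ v, (honest N M D).revenue f v ∂(valuesLaw N D)

end DRA

end

/-! Fix the real bids `v`. Let `W` be the winners if every committed bid, real or fabricated, were
revealed, and `T` the winners once the set `C` is concealed. The smart contract maximizes a weighted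
sum over a matroid, so it is greedy: `i` wins iff its weight is nonnegative and it is not spanned by
the revealed bidders of nonnegative weight served before it (`IsAllocation.mem_iff`). Hence
concealing keeps every real winner of `W`, can only lower its critical bid, and lets in at most
`|C|` newcomers, so each newcomer can be charged a collateral `f` of its own. A newcomer pays at
most its value, so it contributes at most `v i - f`.

The choice of collateral enters here. An MHR virtual value grows at slope at least 1 and is
nonnegative above the reserve, so `v i - f ≤ max (φ i) 0`. Writing the price of a bidder in `W` as
`φ i` plus a defect, the revenue is at most the sum of `max (φ i) 0` over the real bidders of `T`,
plus the defects over `W`. The first sum is at most the honest virtual surplus, since admissibility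
makes that set feasible in the true matroid.

The defects are integrated bidder by bidder. `W` does not depend on the concealment rule, so for
fixed other bids `i` wins exactly above a threshold, and Myerson's computation shows that the
expected defect is nonpositive, whatever regular distribution was reported. Under truthful reports
expected payment and expected virtual value agree, so the honest plan attains the bound. -/

namespace DRA

/-! ## Greedy description of the allocation -/

/-- `j` is served before `i`: its weight is larger, or equal with a smaller identifier. -/
def Before (w : ℕ → EReal) (j i : ℕ) : Prop :=
  w i < w j ∨ (w i = w j ∧ j < i)

/-- The revealed identifiers of nonnegative weight served before `i`. -/
def served (R : Finset ℕ) (w : ℕ → EReal) (i : ℕ) : Set ℕ :=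
  {j | j ∈ R ∧ 0 ≤ w j ∧ Before w j i}

theorem served_mono {R R' : Finset ℕ} (h : R' ⊆ R) (w : ℕ → EReal) (i : ℕ) :
    served R' w i ⊆ served R w i :=
  fun _ hj => ⟨h hj.1, hj.2⟩

theorem served_update_subset {R : Finset ℕ} {w : ℕ → EReal} {i : ℕ} {x : EReal} (h : w i ≤ x) :
    served R (Function.update w i x) i ⊆ served R w i := by
  rintro j ⟨hjR, hj0, hj⟩
  have hji : j ≠ i := by
    rintro rfl
    rcases hj with hj | hj
    · exact lt_irrefl _ hj
    · exact lt_irrefl _ hj.2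
  rw [Function.update_of_ne hji] at hj0
  refine ⟨hjR, hj0, ?_⟩
  simp only [Before, Function.update_self, Function.update_of_ne hji] at hj
  rcases hj with hj | ⟨hj, hlt⟩
  · exact Or.inl (h.trans_lt hj)
  · rcases (h.trans hj.le).lt_or_eq with h' | h'
    · exact Or.inl h'
    · exact Or.inr ⟨h', hlt⟩

section Allocation

variable {M : Matroid ℕ} {R S : Finset ℕ} {w : ℕ → EReal}

theorem IsAllocation.eq_and_precedes (h : IsAllocation M R w S) {T : Finset ℕ}
    (hT : IsFeasible M R T) (hne : T ≠ S) (hle : ∑ i ∈ S, w i ≤ ∑ i ∈ T, w i) :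
    ∑ i ∈ S, w i = ∑ i ∈ T, w i ∧ Precedes S T := by
  rcases h.2 T hT hne with h' | h'
  · exact absurd h' hle.not_gt
  · exact ⟨h'.1.symm, h'.2⟩

theorem sum_ereal_ne_top (hw : ∀ i, w i ≠ ⊤) (S : Finset ℕ) : ∑ i ∈ S, w i ≠ ⊤ := by
  classical
  induction S using Finset.induction_on with
  | empty => simp
  | insert a s ha ih =>
    rw [Finset.sum_insert ha]
    exact (EReal.add_lt_top (hw a) ih).ne

theorem IsAllocation.sum_nonneg (h : IsAllocation M R w S) : 0 ≤ ∑ i ∈ S, w i := by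
  by_contra hlt
  have hne : (∅ : Finset ℕ) ≠ S := by
    rintro rfl
    simp at hlt
  rcases (h.eq_and_precedes (T := ∅) ⟨by simp, by simp⟩ hne (by simpa using (not_le.1 hlt).le)) with
    ⟨h1, -⟩
  rw [h1] at hlt
  simp at hlt

/-- Splitting off one allocated bidder from a nonnegative surplus leaves a finite sum. -/
theorem sum_erase_coe (hw : ∀ i, w i ≠ ⊤) (hS : 0 ≤ ∑ i ∈ S, w i) {i : ℕ} (hi : i ∈ S) :
    ∃ r : ℝ, ∑ k ∈ S.erase i, w k = r ∧ ∑ k ∈ S, w k = w i + r := by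
  have hsum : ∑ k ∈ S, w k = w i + ∑ k ∈ S.erase i, w k := (Finset.add_sum_erase S w hi).symm
  have htop := sum_ereal_ne_top hw (S.erase i)
  have hbot : ∑ k ∈ S.erase i, w k ≠ ⊥ := by
    intro hb
    rw [hsum, hb, EReal.add_bot] at hS
    simp at hS
  exact ⟨(∑ k ∈ S.erase i, w k).toReal, (EReal.coe_toReal htop hbot).symm, by
    rw [hsum, EReal.coe_toReal htop hbot]⟩

/-- Dropping a bidder of negative weight would be a strict gain, even at weight `⊥`, because the
other summands have a finite sum. -/
theorem IsAllocation.nonneg_of_mem (h : IsAllocation M R w S) (hw : ∀ i, w i ≠ ⊤) {i : ℕ}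
    (hi : i ∈ S) : 0 ≤ w i := by
  by_contra hlt
  obtain ⟨r, hr, hS⟩ := sum_erase_coe hw h.sum_nonneg hi
  have hlt' : ∑ k ∈ S, w k < ∑ k ∈ S.erase i, w k := by
    rw [hS, hr]
    simpa using EReal.add_lt_add_right_coe (not_le.1 hlt) r
  have hne : S.erase i ≠ S := Finset.erase_ne_self.2 hi
  have := h.eq_and_precedes (T := S.erase i)
    ⟨(Finset.erase_subset _ _).trans h.1.1, h.1.2.subset (by simp)⟩ hne hlt'.le
  exact hlt'.ne this.1

/-- A superset of no smaller surplus would at worst tie, and the lexicographic rule never prefers a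
set to its proper superset. Bidders of weight zero are thus served whenever possible. -/
theorem IsAllocation.not_indep_insert (h : IsAllocation M R w S) {i : ℕ}
    (hiR : i ∈ R) (hi0 : 0 ≤ w i) (hi : i ∉ S) : ¬ M.Indep (insert i (S : Set ℕ)) := by
  classical
  intro hind
  have hne : insert i S ≠ S := fun he => hi (he ▸ Finset.mem_insert_self i S)
  obtain ⟨-, hp⟩ := h.eq_and_precedes (T := insert i S)
    ⟨Finset.insert_subset hiR h.1.1, by simpa using hind⟩ hne (by
      rw [Finset.sum_insert hi]
      exact le_add_of_nonneg_left hi0)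
  obtain ⟨k, hkS, hk, -⟩ := hp
  exact hk (Finset.mem_insert_of_mem hkS)

/-- A swap that keeps feasibility does not put an earlier bidder in place of a later one. -/
theorem IsAllocation.not_indep_swap (h : IsAllocation M R w S) (hw : ∀ i, w i ≠ ⊤) {i j : ℕ}
    (hi : i ∈ S) (hjR : j ∈ R) (hjS : j ∉ S) (hji : Before w j i) :
    ¬ M.Indep (insert j ((S : Set ℕ) \ {i})) := by
  classical
  intro hind
  obtain ⟨r, hr, hS⟩ := sum_erase_coe hw h.sum_nonneg hi
  have hj' : j ∉ S.erase i := fun hj => hjS (Finset.mem_of_mem_erase hj)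
  have hT : ∑ k ∈ insert j (S.erase i), w k = w j + r := by
    rw [Finset.sum_insert hj', hr]
  have hne : insert j (S.erase i) ≠ S := fun he => hjS (he ▸ Finset.mem_insert_self j _)
  have hle : w i ≤ w j := by
    rcases hji with h1 | h1
    · exact h1.le
    · exact h1.1.le
  obtain ⟨heq, hp⟩ := h.eq_and_precedes (T := insert j (S.erase i))
    ⟨Finset.insert_subset hjR ((Finset.erase_subset _ _).trans h.1.1), by simpa using hind⟩ hne (by
      rw [hT, hS]
      exact add_le_add_left hle _)
  rw [hT, hS] at heq
  rcases hji with h1 | ⟨-, hlt⟩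
  · exact (EReal.add_lt_add_right_coe h1 r).ne heq
  · refine precedes_asymm hp ⟨j, Finset.mem_insert_self _ _, hjS, fun k hk => ?_⟩
    simp only [Finset.mem_insert, Finset.mem_erase]
    have h1 : k ≠ j := hk.ne
    have h2 : k ≠ i := (hk.trans hlt).ne
    tauto

/-- Correctness of the greedy algorithm, by exchange. The criterion refers to the bidders ahead of
`i` and not to the allocation itself, which makes monotonicity in the revealed set and in the own
weight immediate. -/
theorem IsAllocation.mem_iff (h : IsAllocation M R w S) (hw : ∀ i, w i ≠ ⊤)
    (hR : (R : Set ℕ) ⊆ M.E) {i : ℕ} :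
    i ∈ S ↔ i ∈ R ∧ 0 ≤ w i ∧ i ∉ M.closure (served R w i) := by
  have hS := h.1.2
  constructor
  · intro hi
    refine ⟨h.1.1 hi, h.nonneg_of_mem hw hi, fun hcl => ?_⟩
    -- Since `S \ {i}` does not span `i`, it cannot span all bidders ahead of `i`; one that it
    -- misses could replace `i`.
    have hsub : ∃ j ∈ served R w i, j ∉ M.closure ((S : Set ℕ) \ {i}) := by
      by_contra hcon
      push Not at hcon
      exact hS.notMem_closure_sdiff_of_mem (Finset.mem_coe.2 hi)
        (M.closure_subset_closure_of_subset_closure hcon hcl)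
    obtain ⟨j, ⟨hjR, hj0, hji⟩, hj⟩ := hsub
    have hij : j ≠ i := by
      rintro rfl
      rcases hji with hj | hj
      · exact lt_irrefl _ hj
      · exact lt_irrefl _ hj.2
    have hSi := hS.sdiff {i}
    have hjS : j ∉ S := fun hjS => hj (M.subset_closure _ hSi.subset_ground ⟨hjS, hij⟩)
    exact h.not_indep_swap hw hi hjR hjS hji
      (hSi.insert_indep_iff.2 (Or.inl ⟨hR hjR, hj⟩))
  · rintro ⟨hiR, hi0, hcl⟩
    by_contra hiS
    have hicl : i ∈ M.closure (S : Set ℕ) := by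
      by_contra hcl'
      exact h.not_indep_insert hiR hi0 hiS (hS.insert_indep_iff.2 (Or.inl ⟨hR hiR, hcl'⟩))
    -- Look for a later bidder on the fundamental circuit of `i` in `S`. If there were none, `i`
    -- would lie in the closure of `S \ {j}` for every later `j`; for independent `S` these closures
    -- intersect in the closure of `S ∩ served R w i`, which does not contain `i`.
    have hswap : ∃ j ∈ S, j ∉ served R w i ∧ i ∉ M.closure ((S : Set ℕ) \ {j}) := by
      by_contra hcon
      push Not at hcon
      by_cases hne : ((S : Set ℕ) \ served R w i).Nonempty
      · let Js : Set (Set ℕ) := (fun j => (S : Set ℕ) \ {j}) '' ((S : Set ℕ) \ served R w i)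
        have hJs := hS.closure_sInter_eq_biInter_closure_of_forall_subset (Js := Js)
          (hne.image _) (by
            rintro _ ⟨j, -, rfl⟩
            exact Set.sdiff_subset)
        have hmem : i ∈ ⋂ J ∈ Js, M.closure J := by
          simp only [Set.mem_iInter]
          rintro _ ⟨j, hj, rfl⟩
          exact hcon j hj.1 hj.2
        rw [← hJs] at hmem
        refine hcl (M.closure_subset_closure ?_ hmem)
        intro k hk
        by_contra hkP
        obtain ⟨j, hj⟩ := hne
        have hkS : k ∈ S := (hk _ ⟨j, hj, rfl⟩).1
        exact (hk _ ⟨k, ⟨hkS, hkP⟩, rfl⟩).2 rfl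
      · rw [Set.not_nonempty_iff_eq_empty, Set.sdiff_eq_empty] at hne
        exact hcl (M.closure_subset_closure hne hicl)
    obtain ⟨j, hjS, hjP, hj⟩ := hswap
    have hbefore : Before w i j := by
      have hij : i ≠ j := by
        rintro rfl
        exact hiS hjS
      have hnot : ¬ Before w j i := fun hb => hjP ⟨h.1.1 hjS, h.nonneg_of_mem hw hjS, hb⟩
      simp only [Before, not_or, not_and, not_lt] at hnot ⊢
      rcases hnot.1.lt_or_eq with h' | h'
      · exact Or.inl h'
      · exact Or.inr ⟨h', lt_of_le_of_ne (hnot.2 h'.symm) hij⟩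
    exact h.not_indep_swap hw hjS hiR hiS hbefore
      ((hS.sdiff {j}).insert_indep_iff.2 (Or.inl ⟨hR hiR, hj⟩))

end Allocation

/-! ### Monotonicity of the greedy allocation -/

section Winners

variable {M : Matroid ℕ} {R : Finset ℕ} {w : ℕ → EReal}

theorem mem_allocation_iff (hw : ∀ i, w i ≠ ⊤) (hR : (R : Set ℕ) ⊆ M.E) {i : ℕ} :
    i ∈ allocation M R w ↔ i ∈ R ∧ 0 ≤ w i ∧ i ∉ M.closure (served R w i) :=
  (isAllocation_allocation M R w).mem_iff hw hR

theorem allocation_subset : allocation M R w ⊆ R :=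
  (isAllocation_allocation M R w).1.1

theorem allocation_indep : M.Indep (allocation M R w : Set ℕ) :=
  (isAllocation_allocation M R w).1.2

/-- With fewer bids revealed, fewer bidders stand ahead of `i`, and they span less. -/
theorem mem_allocation_of_subset (hw : ∀ i, w i ≠ ⊤) (hR : (R : Set ℕ) ⊆ M.E) {R' : Finset ℕ}
    (hR' : R' ⊆ R) {i : ℕ} (hi : i ∈ R') (h : i ∈ allocation M R w) :
    i ∈ allocation M R' w := by
  rw [mem_allocation_iff hw hR] at h
  rw [mem_allocation_iff hw ((Finset.coe_subset.2 hR').trans hR)]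
  exact ⟨hi, h.2.1, fun hcl => h.2.2 (M.closure_subset_closure (served_mono hR' w i) hcl)⟩

theorem mem_allocation_update (hw : ∀ i, w i ≠ ⊤) (hR : (R : Set ℕ) ⊆ M.E) {i : ℕ} {x : EReal}
    (hx : x ≠ ⊤) (hle : w i ≤ x) (h : i ∈ allocation M R w) :
    i ∈ allocation M R (Function.update w i x) := by
  rw [mem_allocation_iff hw hR] at h
  rw [mem_allocation_iff (fun j => by
    rcases eq_or_ne j i with rfl | hj
    · simpa using hx
    · simpa [hj] using hw j) hR, Function.update_self]
  exact ⟨h.1, h.2.1.trans hle,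
    fun hcl => h.2.2 (M.closure_subset_closure (served_update_subset hle) hcl)⟩

/-- Concealing bids lets at most as many new bidders in. -/
theorem card_allocation_sdiff_le (hw : ∀ i, w i ≠ ⊤) (hR : (R : Set ℕ) ⊆ M.E) (C : Finset ℕ) :
    (allocation M (R \ C) w \ allocation M R w).card ≤ C.card := by
  classical
  set S := allocation M R w
  set T := allocation M (R \ C) w
  -- Otherwise matroid augmentation adds to `S` a bidder of `T`, whose weight is nonnegative. With
  -- `S \ C ⊆ T` this gives `|T \ S| ≤ |S| - |S \ C| ≤ |C|`.
  have hTS : T.card ≤ S.card := by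
    by_contra hlt
    obtain ⟨e, heT, heS, he⟩ := (allocation_indep (M := M) (R := R) (w := w)).augment_finset
      (allocation_indep (M := M) (R := R \ C) (w := w)) (not_le.1 hlt)
    have heR : e ∈ R := Finset.sdiff_subset (allocation_subset heT)
    have he0 : 0 ≤ w e := (isAllocation_allocation M (R \ C) w).nonneg_of_mem hw heT
    exact (isAllocation_allocation M R w).not_indep_insert heR he0 heS (by simpa using he)
  have hsub : S \ C ⊆ T ∩ S := by
    intro i hi
    rw [Finset.mem_sdiff] at hi
    exact Finset.mem_inter.2 ⟨mem_allocation_of_subset hw hR Finset.sdiff_subset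
      (Finset.mem_sdiff.2 ⟨allocation_subset hi.1, hi.2⟩) hi.1, hi.1⟩
  have h1 := Finset.card_le_card hsub
  have h2 := Finset.card_sdiff_add_card_inter T S
  have h3 := Finset.le_card_sdiff C S
  omega

end Winners

/-! ## Virtual values -/

namespace ValueDist

variable (D : ValueDist)

theorem virtualValue_ne_top (v : ℝ) : D.virtualValue v ≠ ⊤ := by
  rw [virtualValue, sub_eq_add_neg]
  refine (EReal.add_lt_top (EReal.coe_ne_top v) ?_).ne
  rw [Ne, EReal.neg_eq_top_iff]
  exact EReal.coe_ennreal_ne_bot _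

variable {D}

theorem Regular.virtualValue_mono (h : D.Regular) {v w : ℝ} (hv : 0 ≤ v) (hvw : v ≤ w) :
    D.virtualValue v ≤ D.virtualValue w := by
  simpa using h v w hv hvw

theorem MHR.regular (h : D.MHR) : D.Regular := by
  intro v w hv hvw
  refine le_trans ?_ (h v w hv hvw)
  gcongr
  exact zero_le_one

end ValueDist

/-! ## Winners and critical bids -/

section CriticalBid

variable {M : Matroid ℕ} {D : ℕ → ValueDist} {R : Finset ℕ} {b : ℕ → ℝ}

theorem weight_update (D : ℕ → ValueDist) (b : ℕ → ℝ) (i : ℕ) (t : ℝ) :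
    (fun j => (D j).virtualValue (Function.update b i t j)) =
      Function.update (fun j => (D j).virtualValue (b j)) i ((D i).virtualValue t) := by
  funext j
  rcases eq_or_ne j i with rfl | hj
  · simp
  · simp [hj]

theorem winners_subset : winners M D R b ⊆ R := allocation_subset

theorem winners_indep : M.Indep (winners M D R b : Set ℕ) := allocation_indep

theorem virtualValue_nonneg_of_mem_winners {i : ℕ} (h : i ∈ winners M D R b) :
    0 ≤ (D i).virtualValue (b i) :=
  (isAllocation_allocation M R _).nonneg_of_mem (fun i => (D i).virtualValue_ne_top (b i)) h

theorem mem_winners_of_subset (hR : (R : Set ℕ) ⊆ M.E) {R' : Finset ℕ} (hR' : R' ⊆ R) {i : ℕ}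
    (hi : i ∈ R') (h : i ∈ winners M D R b) : i ∈ winners M D R' b :=
  mem_allocation_of_subset (fun i => (D i).virtualValue_ne_top (b i)) hR hR' hi h

theorem card_winners_sdiff_le (hR : (R : Set ℕ) ⊆ M.E) (C : Finset ℕ) :
    (winners M D (R \ C) b \ winners M D R b).card ≤ C.card :=
  card_allocation_sdiff_le (fun i => (D i).virtualValue_ne_top (b i)) hR C

/-- The bids with which `i` is allocated. -/
def winningBids (M : Matroid ℕ) (D : ℕ → ValueDist) (R : Finset ℕ) (b : ℕ → ℝ) (i : ℕ) : Set ℝ :=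
  {t : ℝ | 0 ≤ t ∧ i ∈ winners M D R (Function.update b i t)}

/-- A higher bid has no lower reported virtual value, by regularity, and so has no more bidders
ahead of it. This makes the critical bid a threshold. -/
theorem winningBids_upward (hR : (R : Set ℕ) ⊆ M.E) {i : ℕ} (hi : (D i).Regular) {s t : ℝ}
    (hst : s ≤ t) (hs : s ∈ winningBids M D R b i) : t ∈ winningBids M D R b i := by
  refine ⟨hs.1.trans hst, ?_⟩
  have h := mem_allocation_update (fun j => (D j).virtualValue_ne_top _) hR
    ((D i).virtualValue_ne_top t) (by simpa using hi.virtualValue_mono hs.1 hst) hs.2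
  rw [← weight_update, Function.update_idem] at h
  exact h

theorem bddBelow_winningBids (i : ℕ) : BddBelow (winningBids M D R b i) :=
  ⟨0, fun _ h => h.1⟩

theorem criticalBid_nonneg (i : ℕ) : 0 ≤ criticalBid M D R b i :=
  Real.sInf_nonneg fun _ h => h.1

theorem mem_winningBids_iff {i : ℕ} (hb : 0 ≤ b i) :
    b i ∈ winningBids M D R b i ↔ i ∈ winners M D R b := by
  simp [winningBids, hb]

theorem criticalBid_le {i : ℕ} (hb : 0 ≤ b i) (h : i ∈ winners M D R b) :
    criticalBid M D R b i ≤ b i :=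
  csInf_le (bddBelow_winningBids i) ((mem_winningBids_iff hb).2 h)

theorem criticalBid_le_of_subset (hR : (R : Set ℕ) ⊆ M.E) {R' : Finset ℕ} (hR' : R' ⊆ R) {i : ℕ}
    (hi : i ∈ R') (hb : 0 ≤ b i) (h : i ∈ winners M D R b) :
    criticalBid M D R' b i ≤ criticalBid M D R b i :=
  -- That `i` wins under `R` matters: the infimum of an empty set of winning bids would be 0.
  csInf_le_csInf (bddBelow_winningBids i) ⟨b i, (mem_winningBids_iff hb).2 h⟩
    fun _ ht => ⟨ht.1, mem_winners_of_subset hR hR' hi ht.2⟩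

theorem criticalBid_update (i : ℕ) (t : ℝ) :
    criticalBid M D R (Function.update b i t) i = criticalBid M D R b i := by
  simp [criticalBid]

end CriticalBid

namespace ValueDist

variable {D : ValueDist}

/-! ## The inverse hazard rate -/

/-- The inverse hazard rate `(1 - F(v)) / f(v)`. -/
noncomputable def invHazard (D : ValueDist) (v : ℝ) : ℝ≥0∞ :=
  D.law (Set.Ioi v) / (D.density v : ℝ≥0∞)

theorem virtualValue_eq (D : ValueDist) (v : ℝ) :
    D.virtualValue v = (v : EReal) - (D.invHazard v : EReal) := rfl

theorem measurable_tail (D : ValueDist) : Measurable fun v => D.law (Set.Ioi v) :=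
  Antitone.measurable fun _ _ h => measure_mono (Set.Ioi_subset_Ioi h)

theorem measurable_invHazard (D : ValueDist) : Measurable D.invHazard :=
  D.measurable_tail.div D.measurable_density.coe_nnreal_ennreal

theorem measurable_virtualValue (D : ValueDist) : Measurable D.virtualValue := by
  simp only [funext D.virtualValue_eq, sub_eq_add_neg]
  exact measurable_coe_real_ereal.add (D.measurable_invHazard.coe_ereal_ennreal.neg)

theorem virtualValue_eq_coe {v : ℝ} (h : D.invHazard v ≠ ⊤) :
    D.virtualValue v = ((v - (D.invHazard v).toReal : ℝ) : EReal) := by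
  rw [virtualValue_eq, EReal.coe_sub, EReal.coe_ennreal_toReal h]

theorem virtualValue_eq_bot {v : ℝ} (h : D.invHazard v = ⊤) : D.virtualValue v = ⊥ := by
  simp [virtualValue_eq, h]

theorem invHazard_ne_top_of_nonneg {v : ℝ} (h : 0 ≤ D.virtualValue v) : D.invHazard v ≠ ⊤ := by
  intro htop
  rw [virtualValue_eq_bot htop] at h
  simp at h

theorem invHazard_ne_top_of_density {v : ℝ} (h : D.density v ≠ 0) : D.invHazard v ≠ ⊤ :=
  ENNReal.div_ne_top (measure_ne_top _ _) (by simpa using h)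

theorem invHazard_mul_density {v : ℝ} (h : D.invHazard v ≠ ⊤) :
    D.invHazard v * D.density v = D.law (Set.Ioi v) := by
  by_cases h0 : (D.density v : ℝ≥0∞) = 0
  · have : D.law (Set.Ioi v) = 0 := by
      by_contra hne
      exact h (by rw [invHazard, h0, ENNReal.div_zero hne])
    rw [this, h0, mul_zero]
  · exact ENNReal.div_mul_cancel h0 ENNReal.coe_ne_top

/-- Equality can fail only at a zero of the density with larger values still possible, where the
left side is `⊤ * 0 = 0`. -/
theorem invHazard_mul_density_le (v : ℝ) :
    D.invHazard v * D.density v ≤ D.law (Set.Ioi v) := by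
  by_cases h0 : (D.density v : ℝ≥0∞) = 0
  · simp [h0]
  · exact (ENNReal.div_mul_cancel h0 ENNReal.coe_ne_top).le

instance (D : ValueDist) : NullSingletonClass D.law :=
  ⟨fun x => withDensity_absolutelyContinuous _ _ (measure_singleton x)⟩

theorem ae_nonneg (D : ValueDist) : ∀ᵐ v ∂D.law, 0 ≤ v := by
  rw [law, ae_withDensity_iff D.measurable_density.coe_nnreal_ennreal]
  refine Filter.Eventually.of_forall fun v hv => ?_
  by_contra hlt
  exact hv (by simp [D.density_of_neg v (not_le.1 hlt)])

theorem ae_invHazard_ne_top (D : ValueDist) : ∀ᵐ v ∂D.law, D.invHazard v ≠ ⊤ := by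
  rw [law, ae_withDensity_iff D.measurable_density.coe_nnreal_ennreal]
  exact Filter.Eventually.of_forall fun v hv => invHazard_ne_top_of_density (by simpa using hv)

theorem exists_density_ne_zero (D : ValueDist) : ∃ v, 0 ≤ v ∧ D.density v ≠ 0 := by
  by_contra hcon
  push Not at hcon
  have h0 : ∀ v, D.density v = 0 := fun v =>
    (lt_or_ge v 0).elim (D.density_of_neg v) (hcon v)
  simpa [h0] using D.lintegral_density

/-! ## The revenue of a posted price -/

theorem lintegral_tail (D : ValueDist) (p : ℝ) :
    ∫⁻ t in Set.Ioi p, D.law (Set.Ioi t) = ∫⁻ v, ENNReal.ofReal (v - p) ∂D.law := by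
  have h1 : ∫⁻ v, ENNReal.ofReal (v - p) ∂D.law = ∫⁻ v, ENNReal.ofReal (max (v - p) 0) ∂D.law := by
    refine lintegral_congr fun v => ?_
    rw [ENNReal.ofReal, ENNReal.ofReal, Real.toNNReal, Real.toNNReal]
    congr 1
    ext
    simp
  -- Layer-cake formula for `(v - p)⁺`, followed by a translation by `p`.
  rw [h1, lintegral_eq_lintegral_meas_lt (f := fun v => max (v - p) 0) _ (Filter.Eventually.of_forall fun v => le_max_right _ _)
    (by fun_prop)]
  have h2 : ∫⁻ t in Set.Ioi (0 : ℝ), D.law {a | t < max (a - p) 0} =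
      ∫⁻ t in Set.Ioi (0 : ℝ), D.law (Set.Ioi (t + p)) := by
    refine setLIntegral_congr_fun measurableSet_Ioi fun t ht => ?_
    congr 1
    ext a
    have : ¬ t < 0 := not_lt.2 (le_of_lt ht)
    simp [this, lt_sub_iff_add_lt]
  rw [h2]
  have h3 := (measurePreserving_add_right (volume : Measure ℝ) p).setLIntegral_comp_preimage
    (measurableSet_Ioi (a := p)) D.measurable_tail
  rw [← h3]
  simp

/-- Up to its infimum, an upward closed set of values is a half-line. -/
theorem ae_eq_Ioi {U : Set ℝ} (hne : U.Nonempty) (hbdd : BddBelow U)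
    (hU : ∀ s ∈ U, ∀ t, s ≤ t → t ∈ U) : U =ᵐ[D.law] Set.Ioi (sInf U) := by
  have h1 : Set.Ioi (sInf U) ⊆ U := fun t ht => by
    obtain ⟨s, hs, hst⟩ := exists_lt_of_csInf_lt hne ht
    exact hU s hs t hst.le
  have h2 : U ⊆ Set.Ici (sInf U) := fun t ht => csInf_le hbdd ht
  refine Filter.EventuallyLE.antisymm ?_ h1.eventuallyLE
  exact h2.eventuallyLE.trans Ioi_ae_eq_Ici.symm.le

theorem lintegral_price_add (D : ValueDist) {p : ℝ} (hp : 0 ≤ p) :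
    ∫⁻ _ in Set.Ioi p, ENNReal.ofReal p ∂D.law + ∫⁻ t in Set.Ioi p, D.law (Set.Ioi t) =
      ∫⁻ v in Set.Ioi p, ENNReal.ofReal v ∂D.law := by
  have h1 : ∫⁻ v, ENNReal.ofReal (v - p) ∂D.law =
      ∫⁻ v in Set.Ioi p, ENNReal.ofReal (v - p) ∂D.law := by
    rw [← lintegral_indicator measurableSet_Ioi]
    refine lintegral_congr fun v => ?_
    by_cases hv : p < v
    · rw [Set.indicator_of_mem (Set.mem_Ioi.2 hv)]
    · rw [Set.indicator_of_notMem (by simpa using hv)]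
      exact ENNReal.ofReal_of_nonpos (by linarith)
  rw [lintegral_tail, h1, ← lintegral_add_left measurable_const]
  refine setLIntegral_congr_fun measurableSet_Ioi fun v hv => ?_
  have : p < v := hv
  rw [← ENNReal.ofReal_add hp (by linarith)]
  congr 1
  ring

theorem lintegral_invHazard (D : ValueDist) {s : Set ℝ} (hs : MeasurableSet s) :
    ∫⁻ v in s, D.invHazard v ∂D.law = ∫⁻ v in s, D.invHazard v * D.density v := by
  rw [law, setLIntegral_withDensity_eq_setLIntegral_mul _
    D.measurable_density.coe_nnreal_ennreal D.measurable_invHazard hs]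
  exact lintegral_congr fun v => mul_comm _ _

/-- Myerson's lemma for one bidder with winning bids `U`, kept free of subtraction so that no
integrability is needed: on `v > p` one has `v = p + (v - p)`, and `v - p` integrates to the
integral of the tail, which dominates that of the inverse hazard rate. -/
theorem lintegral_price_add_invHazard_le (D : ValueDist) {U : Set ℝ} (hne : U.Nonempty)
    (hU0 : ∀ t ∈ U, 0 ≤ t) (hU : ∀ s ∈ U, ∀ t, s ≤ t → t ∈ U) :
    ∫⁻ v in U, (ENNReal.ofReal (sInf U) + D.invHazard v) ∂D.law ≤
      ∫⁻ v in U, ENNReal.ofReal v ∂D.law := by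
  rw [setLIntegral_congr (ae_eq_Ioi hne ⟨0, hU0⟩ hU), setLIntegral_congr (ae_eq_Ioi hne ⟨0, hU0⟩ hU),
    lintegral_add_left measurable_const, ← lintegral_price_add D (Real.sInf_nonneg hU0),
    lintegral_invHazard D measurableSet_Ioi]
  gcongr with v
  exact invHazard_mul_density_le v

theorem lintegral_price_add_invHazard_eq (D : ValueDist) {U : Set ℝ} (hne : U.Nonempty)
    (hU0 : ∀ t ∈ U, 0 ≤ t) (hU : ∀ s ∈ U, ∀ t, s ≤ t → t ∈ U)
    (hfin : ∀ t ∈ U, D.invHazard t ≠ ⊤) :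
    ∫⁻ v in U, (ENNReal.ofReal (sInf U) + D.invHazard v) ∂D.law =
      ∫⁻ v in U, ENNReal.ofReal v ∂D.law := by
  rw [setLIntegral_congr (ae_eq_Ioi hne ⟨0, hU0⟩ hU), setLIntegral_congr (ae_eq_Ioi hne ⟨0, hU0⟩ hU),
    lintegral_add_left measurable_const, ← lintegral_price_add D (Real.sInf_nonneg hU0),
    lintegral_invHazard D measurableSet_Ioi]
  congr 1
  refine setLIntegral_congr_fun measurableSet_Ioi fun v hv => ?_
  obtain ⟨s, hs, hst⟩ := exists_lt_of_csInf_lt hne hv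
  exact invHazard_mul_density (hfin v (hU s hs v hst.le))

/-! ## Monotone hazard rates -/

theorem MHR.virtualValue_add_le (h : D.MHR) {v w : ℝ} (hv : 0 ≤ v) (hvw : v ≤ w) :
    D.virtualValue v + ((w - v : ℝ) : EReal) ≤ D.virtualValue w := by
  simpa using h v w hv hvw

theorem MHR.invHazard_anti (h : D.MHR) {v w : ℝ} (hv : 0 ≤ v) (hvw : v ≤ w) :
    D.invHazard w ≤ D.invHazard v := by
  by_cases hvt : D.invHazard v = ⊤
  · rw [hvt]
    exact le_top
  have hle := h.virtualValue_add_le hv hvw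
  by_cases hwt : D.invHazard w = ⊤
  · rw [virtualValue_eq_bot hwt, virtualValue_eq_coe hvt, ← EReal.coe_add, le_bot_iff] at hle
    exact absurd hle (EReal.coe_ne_bot _)
  · rw [virtualValue_eq_coe hwt, virtualValue_eq_coe hvt, ← EReal.coe_add, EReal.coe_le_coe_iff]
      at hle
    rw [← ENNReal.toReal_le_toReal hwt hvt]
    linarith

/-- Values with a monotone hazard rate have a finite mean. -/
theorem MHR.lintegral_lt_top (h : D.MHR) : ∫⁻ v, ENNReal.ofReal v ∂D.law < ⊤ := by
  obtain ⟨v₀, hv₀, hd⟩ := D.exists_density_ne_zero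
  have hfin := invHazard_ne_top_of_density hd
  have h0 : ∫⁻ v, ENNReal.ofReal v ∂D.law = ∫⁻ t in Set.Ioi 0, D.law (Set.Ioi t) := by
    rw [lintegral_tail]
    simp
  rw [h0, ← Set.Ioc_union_Ioi_eq_Ioi hv₀]
  refine (lintegral_union_le _ _ _).trans_lt (ENNReal.add_lt_top.2 ⟨?_, ?_⟩)
  · calc ∫⁻ t in Set.Ioc 0 v₀, D.law (Set.Ioi t) ≤ ∫⁻ t in Set.Ioc 0 v₀, 1 :=
          lintegral_mono fun t => prob_le_one
      _ < ⊤ := by simp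
  · calc ∫⁻ t in Set.Ioi v₀, D.law (Set.Ioi t)
        -- The tail equals inverse hazard rate times density, and the former is at most its value at
        -- `v₀`.
        ≤ ∫⁻ t in Set.Ioi v₀, D.invHazard v₀ * D.density t := by
          refine setLIntegral_mono' measurableSet_Ioi fun t ht => ?_
          have hle := h.invHazard_anti hv₀ (le_of_lt ht)
          rw [← invHazard_mul_density (ne_top_of_le_ne_top hfin hle)]
          gcongr
      _ ≤ ∫⁻ t, D.invHazard v₀ * D.density t := setLIntegral_le_lintegral _ _
      _ = D.invHazard v₀ := by
          rw [lintegral_const_mul _ D.measurable_density.coe_nnreal_ennreal, D.lintegral_density,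
            mul_one]
      _ < ⊤ := hfin.lt_top

theorem MHR.bddAbove_negative (h : D.MHR) : BddAbove {v : ℝ | 0 ≤ v ∧ D.virtualValue v < 0} := by
  obtain ⟨v₀, hv₀, hd⟩ := D.exists_density_ne_zero
  have hfin := invHazard_ne_top_of_density hd
  -- From `v₀` on, `φ v ≥ φ v₀ + (v - v₀) = v - invHazard v₀`, which is nonnegative from `invHazard
  -- v₀` on.
  refine ⟨max v₀ (D.invHazard v₀).toReal, fun v hv => ?_⟩
  rcases le_total v v₀ with hle | hle
  · exact hle.trans (le_max_left _ _)
  · have := (h.virtualValue_add_le hv₀ hle).trans_lt hv.2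
    rw [virtualValue_eq_coe hfin, ← EReal.coe_add, ← EReal.coe_zero, EReal.coe_lt_coe_iff] at this
    exact le_trans (by linarith) (le_max_right _ _)

theorem reserve_nonneg (D : ValueDist) : 0 ≤ D.reserve :=
  Real.sSup_nonneg fun _ h => h.1

theorem MHR.sub_reserve_nonpos (h : D.MHR) {v : ℝ} (hv : 0 ≤ v) (hneg : D.virtualValue v < 0) :
    v - D.reserve ≤ 0 :=
  sub_nonpos.2 (le_csSup h.bddAbove_negative ⟨hv, hneg⟩)

/-- The excess of a value over the monopoly reserve is at most the positive part of the virtual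
value. -/
theorem MHR.sub_reserve_le (h : D.MHR) {v : ℝ} (hfin : D.invHazard v ≠ ⊤) :
    v - D.reserve ≤ max (v - (D.invHazard v).toReal) 0 := by
  rcases le_or_gt v D.reserve with hle | hlt
  · exact le_trans (by linarith) (le_max_right _ _)
  refine le_trans ?_ (le_max_left _ _)
  by_contra hcon
  -- The virtual value may be negative at the reserve itself, so the slope bound starts from a point
  -- `w` above it: `φ v ≥ φ w + (v - w) ≥ v - w` forces the inverse hazard rate at `v` to be at most
  -- `w`.
  obtain ⟨w, hrw, hw⟩ : ∃ w, D.reserve < w ∧ w < min v (D.invHazard v).toReal :=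
    exists_between (lt_min hlt (by linarith))
  have hw0 : 0 ≤ w := D.reserve_nonneg.trans hrw.le
  have hnn : 0 ≤ D.virtualValue w := by
    by_contra hneg
    linarith [h.sub_reserve_nonpos hw0 (not_le.1 hneg)]
  have hwv : w ≤ v := (hw.trans_le (min_le_left _ _)).le
  have hle := h.virtualValue_add_le hw0 hwv
  rw [virtualValue_eq_coe hfin, virtualValue_eq_coe (invHazard_ne_top_of_nonneg hnn),
    ← EReal.coe_add, EReal.coe_le_coe_iff] at hle
  rw [virtualValue_eq_coe (invHazard_ne_top_of_nonneg hnn), ← EReal.coe_zero,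
    EReal.coe_le_coe_iff] at hnn
  linarith [hw.trans_le (min_le_right v (D.invHazard v).toReal)]

end ValueDist

/-! ## Measurability -/

section Measurability

variable (M : Matroid ℕ) (D : ℕ → ValueDist) (R : Finset ℕ)

theorem measurable_surplus (S : Finset ℕ) :
    Measurable fun b : ℕ → ℝ => ∑ i ∈ S, (D i).virtualValue (b i) :=
  Finset.measurable_sum S fun i _ => (D i).measurable_virtualValue.comp (measurable_pi_apply i)

theorem measurableSet_winners_eq (S : Finset ℕ) :
    MeasurableSet {b : ℕ → ℝ | winners M D R b = S} := by
  have heq : {b : ℕ → ℝ | winners M D R b = S} =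
      {b | IsAllocation M R (fun i => (D i).virtualValue (b i)) S} := by
    ext b
    constructor
    · rintro rfl
      exact isAllocation_allocation M R _
    · exact fun h => (existsUnique_isAllocation M R _).unique (isAllocation_allocation M R _) h
  rw [heq]
  refine MeasurableSet.inter (MeasurableSet.const _) ?_
  refine measurableSet_setOfPred.2 (Measurable.forall fun T => ?_)
  refine measurable_const.imp (measurable_const.imp (Measurable.or ?_ (Measurable.and ?_ ?_)))
  · exact measurableSet_setOfPred.1
      (measurableSet_lt (measurable_surplus D T) (measurable_surplus D S))
  · exact measurableSet_setOfPred.1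
      (measurableSet_eq_fun (measurable_surplus D T) (measurable_surplus D S))
  · exact measurable_const

theorem measurableSet_mem_winners (i : ℕ) : MeasurableSet {b : ℕ → ℝ | i ∈ winners M D R b} := by
  have heq : {b : ℕ → ℝ | i ∈ winners M D R b} =
      ⋃ S : Finset ℕ, ⋃ _ : i ∈ S, {b | winners M D R b = S} := by
    ext b
    simp
  rw [heq]
  exact MeasurableSet.iUnion fun S => MeasurableSet.iUnion fun _ => measurableSet_winners_eq M D R S

theorem measurableSet_mem_winningBids (i : ℕ) (t : ℝ) :
    MeasurableSet {b : ℕ → ℝ | t ∈ winningBids M D R b i} := by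
  have hup : Measurable fun b : ℕ → ℝ => Function.update b i t := by
    refine measurable_pi_iff.2 fun j => ?_
    rcases eq_or_ne j i with rfl | hj
    · simp
    · simpa [hj] using measurable_pi_apply j
  exact (MeasurableSet.const _).inter (hup (measurableSet_mem_winners M D R i))

variable {M D R}

theorem measurable_criticalBid (hR : (R : Set ℕ) ⊆ M.E) {i : ℕ} (hi : (D i).Regular) :
    Measurable fun b => criticalBid M D R b i := by
  refine measurable_of_Iio fun c => ?_
  -- Upward closure lets rational bids witness an infimum below `c`. The second set covers bidders
  -- with no winning bid, whose infimum is 0 by default.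
  have heq : (fun b => criticalBid M D R b i) ⁻¹' Set.Iio c =
      (⋃ q : ℚ, ⋃ _ : (q : ℝ) < c, {b | (q : ℝ) ∈ winningBids M D R b i}) ∪
        ((⋂ q : ℚ, {b | (q : ℝ) ∈ winningBids M D R b i}ᶜ) ∩ {_b | 0 < c}) := by
    ext b
    simp only [Set.mem_preimage, Set.mem_Iio, Set.mem_union, Set.mem_iUnion, Set.mem_inter_iff,
      Set.mem_iInter, Set.mem_compl_iff, Set.mem_ofPred_eq, exists_prop]
    change sInf (winningBids M D R b i) < c ↔ _
    rcases (winningBids M D R b i).eq_empty_or_nonempty with he | hne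
    · simp [he]
    · constructor
      · intro hlt
        obtain ⟨t, ht, htc⟩ := exists_lt_of_csInf_lt hne hlt
        obtain ⟨q, htq, hqc⟩ := exists_rat_btwn htc
        exact Or.inl ⟨q, hqc, winningBids_upward hR hi htq.le ht⟩
      · rintro (⟨q, hqc, hq⟩ | ⟨hno, -⟩)
        · exact (csInf_le (bddBelow_winningBids i) hq).trans_lt hqc
        · obtain ⟨t, ht⟩ := hne
          obtain ⟨q, htq⟩ := exists_rat_gt t
          exact absurd (winningBids_upward hR hi htq.le ht) (hno q)
  rw [heq]
  refine MeasurableSet.union (MeasurableSet.iUnion fun q => MeasurableSet.iUnion fun _ =>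
    measurableSet_mem_winningBids M D R i q) (MeasurableSet.inter (MeasurableSet.iInter fun q =>
    (measurableSet_mem_winningBids M D R i q).compl) (MeasurableSet.const _))

end Measurability

/-! ### Bids and revenue of a plan -/

namespace Plan

variable {N : Finset ℕ} (π : Plan N)

theorem bids_coe (v : N → ℝ) (i : N) : π.bids v i = v i := by
  simp [bids]

theorem bids_update (v : N → ℝ) (i : N) (t : ℝ) :
    π.bids (Function.update v i t) = Function.update (π.bids v) i t := by
  funext j
  by_cases hj : j ∈ N
  · by_cases hji : j = i
    · subst hji
      simp [bids]
    · have : (⟨j, hj⟩ : N) ≠ i := fun h => hji (congrArg Subtype.val h)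
      simp [bids, hj, hji, this]
  · have hji : j ≠ i := fun h => hj (h ▸ i.2)
    simp [bids, hj, hji]

theorem measurable_bids : Measurable π.bids := by
  refine measurable_pi_iff.2 fun j => ?_
  by_cases hj : j ∈ N
  · simpa [bids, hj] using measurable_pi_apply (⟨j, hj⟩ : N)
  · simp [bids, hj]

/-- Payments of the real winners, summed over all real bidders. -/
theorem sum_realWinners {α : Type*} [AddCommMonoid α] (W : Finset ℕ) (g : ℕ → α) :
    ∑ i ∈ W ∩ N, g i = ∑ i : N, if (i : ℕ) ∈ W then g i else 0 := by
  rw [Finset.sum_coe_sort N fun i => if i ∈ W then g i else 0, Finset.sum_ite_mem,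
    Finset.inter_comm]

/-- The revenue when the bids of `C` are concealed. -/
noncomputable def revenueOf (f : ℝ) (C : Finset ℕ) (v : N → ℝ) : ℝ :=
  (∑ i : N, if (i : ℕ) ∈ winners π.matroid π.report ((N ∪ π.fakes) \ C) (π.bids v) then
    criticalBid π.matroid π.report ((N ∪ π.fakes) \ C) (π.bids v) i else 0) - f * C.card

theorem revenue_eq_revenueOf (f : ℝ) (v : N → ℝ) :
    π.revenue f v = π.revenueOf f (π.conceal v) v := by
  rw [revenue, realWinners, sum_realWinners]
  rfl

variable {π} {M : Matroid ℕ}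

theorem Admissible.coe_subset_ground (h : π.Admissible M) {R : Finset ℕ} (hR : R ⊆ N ∪ π.fakes) :
    (R : Set ℕ) ⊆ π.matroid.E := by
  rw [h.ground]
  exact Finset.coe_subset.2 hR

theorem Admissible.report_regular_coe (h : π.Admissible M) (i : N) : (π.report i).Regular :=
  h.report_regular i (Finset.mem_union_left _ i.2)

theorem Admissible.measurable_revenueOf (h : π.Admissible M) (f : ℝ) (C : Finset ℕ) :
    Measurable (π.revenueOf f C) := by
  refine Measurable.sub (Finset.measurable_sum _ fun i _ => ?_) measurable_const
  exact Measurable.ite (π.measurable_bids (measurableSet_mem_winners _ _ _ _))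
    ((measurable_criticalBid (h.coe_subset_ground Finset.sdiff_subset)
      (h.report_regular_coe i)).comp π.measurable_bids) measurable_const

theorem Admissible.measurable_revenue (h : π.Admissible M) (f : ℝ) : Measurable (π.revenue f) := by
  have heq : π.revenue f = fun v => ∑ C ∈ π.fakes.powerset,
      if π.conceal v = C then π.revenueOf f C v else 0 := by
    funext v
    rw [revenue_eq_revenueOf, Finset.sum_ite_eq,
      if_pos (Finset.mem_powerset.2 (h.conceal_subset v))]
  rw [heq]
  exact Finset.measurable_sum _ fun C _ =>
    Measurable.ite (h.measurable_conceal C) (h.measurable_revenueOf f C) measurable_const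

end Plan

theorem honest_admissible {N : Finset ℕ} {M : Matroid ℕ} {D : ℕ → ValueDist}
    (hM : M.E = (N : Set ℕ)) (hD : ∀ i ∈ N, (D i).MHR) : (honest N M D).Admissible M where
  disjoint := by simp [honest]
  fakeBid_nonneg := by simp [honest]
  ground := by simp [honest, hM]
  report_regular := by
    intro i hi
    exact (hD i (by simpa [honest] using hi)).regular
  conceal_subset := by simp [honest]
  measurable_conceal := fun C => MeasurableSet.const ((∅ : Finset ℕ) = C)
  feasible := fun v _ => winners_indep.subset (by
    rw [Plan.realWinners, Finset.coe_inter]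
    exact Set.inter_subset_left)

/-- The virtual value as a real number (meaningful where the inverse hazard rate is finite). -/
noncomputable def ValueDist.realVirtualValue (D : ValueDist) (v : ℝ) : ℝ :=
  v - (D.invHazard v).toReal

instance (N : Finset ℕ) (D : ℕ → ValueDist) : IsProbabilityMeasure (valuesLaw N D) :=
  inferInstanceAs (IsProbabilityMeasure (Measure.pi fun i : N => (D i).law))

/-! ### Integrability under the joint law of the values -/

section Law

variable {N : Finset ℕ} {D : ℕ → ValueDist}

theorem measurePreserving_value (N : Finset ℕ) (D : ℕ → ValueDist) (i : N) :
    MeasurePreserving (fun v : N → ℝ => v i) (valuesLaw N D) (D i).law :=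
  measurePreserving_eval (fun i : N => (D i).law) i

theorem ae_value {p : ℕ → ℝ → Prop} (h : ∀ i : N, ∀ᵐ t ∂(D i).law, p i t) :
    ∀ᵐ v ∂(valuesLaw N D), ∀ i : N, p i (v i) :=
  ae_all_iff.2 fun i => (measurePreserving_value N D i).quasiMeasurePreserving.ae (h i)

theorem ValueDist.MHR.integrable_id {D : ValueDist} (h : D.MHR) :
    Integrable (fun v : ℝ => v) D.law := by
  refine ⟨measurable_id.aestronglyMeasurable, ?_⟩
  rw [hasFiniteIntegral_iff_ofReal D.ae_nonneg]
  exact h.lintegral_lt_top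

/-- Myerson's inequality at price 0 bounds the mean inverse hazard rate by the mean value. -/
theorem ValueDist.MHR.integrable_invHazard {D : ValueDist} (h : D.MHR) :
    Integrable (fun v : ℝ => (D.invHazard v).toReal) D.law := by
  refine integrable_toReal_of_lintegral_ne_top D.measurable_invHazard.aemeasurable ?_
  have hle := D.lintegral_price_add_invHazard_le (U := Set.Ici 0) ⟨0, Set.mem_Ici.2 le_rfl⟩ (fun _ ht => ht)
    fun s hs t hst => le_trans hs hst
  have hae : (Set.Ici 0 : Set ℝ) =ᵐ[D.law] Set.univ := by
    filter_upwards [D.ae_nonneg] with v hv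
    exact propext ⟨fun _ => trivial, fun _ => hv⟩
  rw [setLIntegral_congr hae, setLIntegral_congr hae, Measure.restrict_univ] at hle
  refine ne_top_of_le_ne_top h.lintegral_lt_top.ne (le_trans ?_ hle)
  exact lintegral_mono fun v => le_add_self

theorem integrable_value {i : N} (h : (D i).MHR) :
    Integrable (fun v : N → ℝ => v i) (valuesLaw N D) :=
  (measurePreserving_value N D i).integrable_comp_of_integrable h.integrable_id

theorem integrable_realVirtualValue {i : N} (h : (D i).MHR) :
    Integrable (fun v : N → ℝ => (D i).realVirtualValue (v i)) (valuesLaw N D) :=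
  (measurePreserving_value N D i).integrable_comp_of_integrable
    (h.integrable_id.sub h.integrable_invHazard)

end Law

/-! ## Expected payments and virtual values -/

namespace Plan

variable {N : Finset ℕ} {D : ℕ → ValueDist} {π : Plan N} {M : Matroid ℕ}

/-- The event that `i` is allocated when `R` is revealed. -/
def winEvent (π : Plan N) (R : Finset ℕ) (i : N) : Set (N → ℝ) :=
  {v | (i : ℕ) ∈ winners π.matroid π.report R (π.bids v)}

noncomputable instance (π : Plan N) (R : Finset ℕ) (i : N) (v : N → ℝ) : Decidable (v ∈ π.winEvent R i) :=
  inferInstanceAs (Decidable ((i : ℕ) ∈ winners π.matroid π.report R (π.bids v)))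

/-- The critical bid of `i` when `R` is revealed. -/
noncomputable def price (π : Plan N) (R : Finset ℕ) (i : N) (v : N → ℝ) : ℝ :=
  criticalBid π.matroid π.report R (π.bids v) i

theorem measurableSet_winEvent (R : Finset ℕ) (i : N) : MeasurableSet (π.winEvent R i) :=
  π.measurable_bids (measurableSet_mem_winners _ _ _ _)

theorem Admissible.measurable_price (h : π.Admissible M) {R : Finset ℕ} (hR : R ⊆ N ∪ π.fakes)
    (i : N) : Measurable (π.price R i) :=
  (measurable_criticalBid (h.coe_subset_ground hR) (h.report_regular_coe i)).comp π.measurable_bids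

theorem price_nonneg (R : Finset ℕ) (i : N) (v : N → ℝ) : 0 ≤ π.price R i v :=
  criticalBid_nonneg _

theorem price_update (R : Finset ℕ) (i : N) (v : N → ℝ) (t : ℝ) :
    π.price R i (Function.update v i t) = π.price R i v := by
  rw [price, bids_update, criticalBid_update, price]

theorem price_le {R : Finset ℕ} {i : N} {v : N → ℝ} (hv : 0 ≤ v i) (h : v ∈ π.winEvent R i) :
    π.price R i v ≤ v i := by
  have := criticalBid_le (b := π.bids v) (by rwa [bids_coe]) h
  rwa [bids_coe] at this

theorem winEvent_update_ae (R : Finset ℕ) (i : N) (v : N → ℝ) :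
    (fun t => Function.update v i t) ⁻¹' π.winEvent R i =ᵐ[(D i).law]
      winningBids π.matroid π.report R (π.bids v) i := by
  filter_upwards [(D i).ae_nonneg] with t ht
  refine propext ?_
  change (i : ℕ) ∈ winners _ _ _ (π.bids (Function.update v i t)) ↔ 0 ≤ t ∧ _
  rw [bids_update]
  exact (and_iff_right ht).symm

theorem lmarginal_setLIntegral (R : Finset ℕ) (i : N) (v : N → ℝ) (F : (N → ℝ) → ℝ≥0∞) :
    (∫⋯∫⁻_{i}, (π.winEvent R i).indicator F ∂(fun i : N => (D i).law)) v =
      ∫⁻ t in winningBids π.matroid π.report R (π.bids v) i, F (Function.update v i t) ∂(D i).law := by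
  have hm : MeasurableSet ((fun t => Function.update v i t) ⁻¹' π.winEvent R i) :=
    measurable_update v (measurableSet_winEvent R i)
  rw [lmarginal_singleton, ← setLIntegral_congr (winEvent_update_ae R i v), ← lintegral_indicator hm]
  rfl

/-- Integrate over the value of `i` alone: with `R` fixed, the price is constant on each slice and
the winning bids are upward closed. A revealed set depending on `v` would break both, which is why
concealment is handled pointwise. -/
theorem Admissible.setLIntegral_price_add_le (h : π.Admissible M) {R : Finset ℕ}
    (hR : R ⊆ N ∪ π.fakes) (i : N) :
    ∫⁻ v in π.winEvent R i, (ENNReal.ofReal (π.price R i v) + (D i).invHazard (v i))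
        ∂(valuesLaw N D) ≤
      ∫⁻ v in π.winEvent R i, ENNReal.ofReal (v i) ∂(valuesLaw N D) := by
  have hW := π.measurableSet_winEvent R i
  rw [← lintegral_indicator hW, ← lintegral_indicator hW]
  refine lintegral_le_of_lmarginal_le {i}
    (((h.measurable_price hR i).ennreal_ofReal.add
      ((D i).measurable_invHazard.comp (measurable_pi_apply i))).indicator hW)
    ((measurable_pi_apply i).ennreal_ofReal.indicator hW) fun v => ?_
  rw [lmarginal_setLIntegral, lmarginal_setLIntegral]
  simp only [price_update, Function.update_self]
  rcases (winningBids π.matroid π.report R (π.bids v) i).eq_empty_or_nonempty with he | hne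
  · simp [he]
  · exact (D i).lintegral_price_add_invHazard_le hne (fun t ht => ht.1) fun s hs t hst =>
      winningBids_upward (h.coe_subset_ground hR) (h.report_regular_coe i) hst hs

theorem Admissible.setLIntegral_price_add_eq (h : π.Admissible M) {R : Finset ℕ}
    (hR : R ⊆ N ∪ π.fakes) (i : N) (hD : π.report i = D i) :
    ∫⁻ v in π.winEvent R i, (ENNReal.ofReal (π.price R i v) + (D i).invHazard (v i))
        ∂(valuesLaw N D) =
      ∫⁻ v in π.winEvent R i, ENNReal.ofReal (v i) ∂(valuesLaw N D) := by
  have hW := π.measurableSet_winEvent R i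
  rw [← lintegral_indicator hW, ← lintegral_indicator hW]
  refine lintegral_eq_of_lmarginal_eq {i}
    (((h.measurable_price hR i).ennreal_ofReal.add
      ((D i).measurable_invHazard.comp (measurable_pi_apply i))).indicator hW)
    ((measurable_pi_apply i).ennreal_ofReal.indicator hW) (funext fun v => ?_)
  rw [lmarginal_setLIntegral, lmarginal_setLIntegral]
  simp only [price_update, Function.update_self]
  rcases (winningBids π.matroid π.report R (π.bids v) i).eq_empty_or_nonempty with he | hne
  · simp [he]
  · refine (D i).lintegral_price_add_invHazard_eq hne (fun t ht => ht.1) (fun s hs t hst =>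
      winningBids_upward (h.coe_subset_ground hR) (h.report_regular_coe i) hst hs) fun t ht => ?_
    -- A truthful report excludes winning at virtual value `-∞`, the only case in which the
    -- inequality could be strict.
    have hnn := virtualValue_nonneg_of_mem_winners ht.2
    rw [Function.update_self, hD] at hnn
    exact ValueDist.invHazard_ne_top_of_nonneg hnn

theorem Admissible.integrableOn_price (h : π.Admissible M) {R : Finset ℕ} (hR : R ⊆ N ∪ π.fakes)
    {i : N} (hi : (D i).MHR) : IntegrableOn (π.price R i) (π.winEvent R i) (valuesLaw N D) := by
  refine Integrable.mono' (integrable_value hi).integrableOn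
    (h.measurable_price hR i).aestronglyMeasurable ?_
  have hnn : ∀ᵐ v ∂(valuesLaw N D), ∀ i : N, 0 ≤ v i :=
    ae_value (p := fun _ t => 0 ≤ t) fun i => (D i).ae_nonneg
  rw [ae_restrict_iff' (π.measurableSet_winEvent R i)]
  filter_upwards [hnn] with v hv hw
  rw [Real.norm_of_nonneg (price_nonneg R i v)]
  exact price_le (hv i) hw

/-- The defect between expected virtual value and expected payment, as a difference of integrals
of nonnegative functions. -/
theorem Admissible.setIntegral_price_sub (h : π.Admissible M) {R : Finset ℕ}
    (hR : R ⊆ N ∪ π.fakes) {i : N} (hi : (D i).MHR) :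
    ∫ v in π.winEvent R i, π.price R i v ∂(valuesLaw N D) -
        ∫ v in π.winEvent R i, (D i).realVirtualValue (v i) ∂(valuesLaw N D) =
      (∫⁻ v in π.winEvent R i, (ENNReal.ofReal (π.price R i v) + (D i).invHazard (v i))
        ∂(valuesLaw N D)).toReal -
      (∫⁻ v in π.winEvent R i, ENNReal.ofReal (v i) ∂(valuesLaw N D)).toReal := by
  have hfin : ∀ᵐ v ∂(valuesLaw N D), ∀ i : N, (D i).invHazard (v i) ≠ ⊤ :=
    ae_value (p := fun i t => (D i).invHazard t ≠ ⊤) fun i => (D i).ae_invHazard_ne_top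
  have hnn : ∀ᵐ v ∂(valuesLaw N D), ∀ i : N, 0 ≤ v i :=
    ae_value (p := fun _ t => 0 ≤ t) fun i => (D i).ae_nonneg
  have hmh : Measurable fun v : N → ℝ => ((D i).invHazard (v i)).toReal :=
    ((D i).measurable_invHazard.comp (measurable_pi_apply i)).ennreal_toReal
  have h1 : ∫⁻ v in π.winEvent R i, (ENNReal.ofReal (π.price R i v) + (D i).invHazard (v i))
      ∂(valuesLaw N D) = ∫⁻ v in π.winEvent R i,
        ENNReal.ofReal (π.price R i v + ((D i).invHazard (v i)).toReal) ∂(valuesLaw N D) := by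
    refine lintegral_congr_ae (ae_restrict_of_ae ?_)
    filter_upwards [hfin] with v hv
    rw [ENNReal.ofReal_add (price_nonneg R i v) ENNReal.toReal_nonneg, ENNReal.ofReal_toReal (hv i)]
  rw [h1, ← integral_eq_lintegral_of_nonneg_ae (Filter.Eventually.of_forall fun v =>
      add_nonneg (price_nonneg R i v) ENNReal.toReal_nonneg)
      ((h.measurable_price hR i).add hmh).aestronglyMeasurable,
    ← integral_eq_lintegral_of_nonneg_ae (ae_restrict_of_ae (by
      filter_upwards [hnn] with v hv using hv i)) (measurable_pi_apply i).aestronglyMeasurable]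
  have hI : Integrable (fun v : N → ℝ => ((D i).invHazard (v i)).toReal) (valuesLaw N D) :=
    (measurePreserving_value N D i).integrable_comp_of_integrable hi.integrable_invHazard
  rw [integral_add (h.integrableOn_price hR hi) hI.integrableOn]
  simp only [ValueDist.realVirtualValue]
  rw [integral_sub (integrable_value hi).integrableOn hI.integrableOn]
  ring

theorem setLIntegral_value_ne_top {i : N} (hi : (D i).MHR) (s : Set (N → ℝ)) :
    ∫⁻ v in s, ENNReal.ofReal (v i) ∂(valuesLaw N D) ≠ ⊤ := by
  refine ((setLIntegral_le_lintegral _ _).trans_lt ?_).ne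
  rw [(measurePreserving_value N D i).lintegral_comp (f := fun t => ENNReal.ofReal t)
    ENNReal.measurable_ofReal]
  exact hi.lintegral_lt_top

/-- The expected payment of a bidder is at most its expected virtual value. -/
theorem Admissible.setIntegral_price_le (h : π.Admissible M) {R : Finset ℕ}
    (hR : R ⊆ N ∪ π.fakes) {i : N} (hi : (D i).MHR) :
    ∫ v in π.winEvent R i, π.price R i v ∂(valuesLaw N D) ≤
      ∫ v in π.winEvent R i, (D i).realVirtualValue (v i) ∂(valuesLaw N D) := by
  rw [← sub_nonpos, h.setIntegral_price_sub hR hi, sub_nonpos]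
  exact ENNReal.toReal_mono (setLIntegral_value_ne_top hi _) (h.setLIntegral_price_add_le hR i)

/-- Under a truthful report, the expected payment of a bidder is its expected virtual value. -/
theorem Admissible.setIntegral_price_eq (h : π.Admissible M) {R : Finset ℕ}
    (hR : R ⊆ N ∪ π.fakes) {i : N} (hi : (D i).MHR) (hD : π.report i = D i) :
    ∫ v in π.winEvent R i, π.price R i v ∂(valuesLaw N D) =
      ∫ v in π.winEvent R i, (D i).realVirtualValue (v i) ∂(valuesLaw N D) := by
  rw [← sub_eq_zero, h.setIntegral_price_sub hR hi, sub_eq_zero, h.setLIntegral_price_add_eq hR i hD]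

theorem Admissible.integral_sum_price_eq (h : π.Admissible M) {R : Finset ℕ}
    (hR : R ⊆ N ∪ π.fakes) (hi : ∀ i ∈ N, (D i).MHR) (hD : ∀ i ∈ N, π.report i = D i) :
    ∫ v, ∑ i : N, (π.winEvent R i).indicator (π.price R i) v ∂(valuesLaw N D) =
      ∫ v, ∑ i : N, (π.winEvent R i).indicator (fun v => (D i).realVirtualValue (v i)) v
        ∂(valuesLaw N D) := by
  have hW := π.measurableSet_winEvent R
  have h1 : ∀ i : N, Integrable ((π.winEvent R i).indicator (π.price R i)) (valuesLaw N D) :=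
    fun i => (integrable_indicator_iff (hW i)).2 (h.integrableOn_price hR (hi i i.2))
  have h2 : ∀ i : N, Integrable ((π.winEvent R i).indicator
      fun v => (D i).realVirtualValue (v i)) (valuesLaw N D) :=
    fun i => (integrable_realVirtualValue (hi i i.2)).indicator (hW i)
  rw [integral_finsetSum _ fun i _ => h1 i, integral_finsetSum _ fun i _ => h2 i]
  refine Finset.sum_congr rfl fun i _ => ?_
  rw [integral_indicator (hW i), integral_indicator (hW i)]
  exact h.setIntegral_price_eq hR (hi i i.2) (hD i i.2)

/-! ## Integrability of the revenue -/

theorem Admissible.integrable_revenue (h : π.Admissible M) (hD : ∀ i ∈ N, (D i).MHR) (f : ℝ) :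
    Integrable (π.revenue f) (valuesLaw N D) := by
  have hsum : Integrable (fun v : N → ℝ => ∑ i : N, v i) (valuesLaw N D) :=
    integrable_finsetSum Finset.univ fun i _ => integrable_value (hD i i.2)
  have hdom : Integrable (fun v : N → ℝ => ∑ i : N, v i + |f| * π.fakes.card) (valuesLaw N D) :=
    hsum.add (integrable_const (|f| * (π.fakes.card : ℝ)))
  refine hdom.mono' (h.measurable_revenue f).aestronglyMeasurable ?_
  have hnn : ∀ᵐ v ∂(valuesLaw N D), ∀ i : N, 0 ≤ v i :=
    ae_value (p := fun _ t => 0 ≤ t) fun i => (D i).ae_nonneg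
  filter_upwards [hnn] with v hv
  rw [revenue_eq_revenueOf, revenueOf, Real.norm_eq_abs]
  refine (abs_sub _ _).trans (add_le_add ?_ ?_)
  · rw [abs_of_nonneg (Finset.sum_nonneg fun i _ => by
      split_ifs
      · exact criticalBid_nonneg _
      · exact le_rfl)]
    refine Finset.sum_le_sum fun i _ => ?_
    split_ifs with hw
    · exact price_le (hv i) hw
    · exact hv i
  · rw [abs_mul, Nat.abs_cast]
    gcongr
    exact h.conceal_subset v

/-! ## Comparison with the optimal virtual surplus -/

/-- The revenue is at most the payments without concealment, plus, for every bidder let in by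
concealing, the excess of its value over the collateral. -/
theorem Admissible.revenue_le (h : π.Admissible M) {f : ℝ} (hf : 0 ≤ f) {v : N → ℝ}
    (hv : ∀ i, 0 ≤ v i) :
    π.revenue f v ≤ ∑ i : N, if v ∈ π.winEvent (π.revealed v) i then
      (if v ∈ π.winEvent (N ∪ π.fakes) i then π.price (N ∪ π.fakes) i v else v i - f) else 0 := by
  classical
  have hE := h.coe_subset_ground (Finset.Subset.refl _)
  set C := π.conceal v
  set W := winners π.matroid π.report (N ∪ π.fakes) (π.bids v)
  set T := winners π.matroid π.report ((N ∪ π.fakes) \ C) (π.bids v)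
  have hmem : ∀ i : N, (i : ℕ) ∈ (N ∪ π.fakes) \ C := fun i => Finset.mem_sdiff.2
    ⟨Finset.mem_union_left _ i.2,
      fun hc => Finset.disjoint_left.1 h.disjoint i.2 (h.conceal_subset v hc)⟩
  -- Spread the forfeited collateral over the newcomers, one `f` each.
  have hcard : (∑ i : N, if (i : ℕ) ∈ T \ W then f else 0) ≤ f * C.card := by
    rw [← sum_realWinners (T \ W) fun _ => f, Finset.sum_const, nsmul_eq_mul, mul_comm]
    refine mul_le_mul_of_nonneg_left (Nat.cast_le.2 ?_) hf
    exact (Finset.card_le_card Finset.inter_subset_left).trans (card_winners_sdiff_le hE C)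
  rw [revenue_eq_revenueOf, revenueOf, sub_le_iff_le_add]
  refine le_trans ?_ (add_le_add_right hcard _)
  rw [← Finset.sum_add_distrib]
  refine Finset.sum_le_sum fun i _ => ?_
  have hb : 0 ≤ π.bids v i := by rw [bids_coe]; exact hv i
  change (if (i : ℕ) ∈ T then _ else _) ≤ (if (i : ℕ) ∈ T then
    (if (i : ℕ) ∈ W then _ else _) else _) + _
  by_cases hT : (i : ℕ) ∈ T
  · by_cases hW : (i : ℕ) ∈ W
    · simp only [hT, hW, if_true, Finset.mem_sdiff, not_true, and_false, if_false, add_zero]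
      exact criticalBid_le_of_subset hE Finset.sdiff_subset (hmem i) hb hW
    · simp only [hT, hW, if_true, Finset.mem_sdiff, not_false_iff, and_true, if_false]
      have := criticalBid_le hb hT
      rw [bids_coe] at this
      linarith
  · simp [hT]

end Plan

theorem sum_virtualValue_eq_coe {D : ℕ → ValueDist} {b : ℕ → ℝ} {S : Finset ℕ}
    (hS : ∀ i ∈ S, (D i).invHazard (b i) ≠ ⊤) :
    ∑ i ∈ S, (D i).virtualValue (b i) = ((∑ i ∈ S, (D i).realVirtualValue (b i) : ℝ) : EReal) := by
  rw [Finset.sum_congr rfl fun i hi => ValueDist.virtualValue_eq_coe (hS i hi)]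
  exact (map_sum (⟨⟨Real.toEReal, EReal.coe_zero⟩, EReal.coe_add⟩ : ℝ →+ EReal) _ S).symm

/-- The winners maximize the sum of the positive parts of the virtual values. -/
theorem sum_max_le_sum_winners {M : Matroid ℕ} {D : ℕ → ValueDist} {R : Finset ℕ} {b : ℕ → ℝ}
    (hfin : ∀ i ∈ R, (D i).invHazard (b i) ≠ ⊤) {T : Finset ℕ} (hT : M.Indep (T : Set ℕ))
    (hTR : T ⊆ R) :
    ∑ i ∈ T, max ((D i).realVirtualValue (b i)) 0 ≤
      ∑ i ∈ winners M D R b, (D i).realVirtualValue (b i) := by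
  classical
  -- The sum of positive parts over `T` is the surplus of its members of nonnegative virtual value,
  -- again a feasible set.
  have hsub : {i ∈ T | 0 ≤ (D i).realVirtualValue (b i)} ⊆ T := Finset.filter_subset _ _
  have h1 : ∑ i ∈ T, max ((D i).realVirtualValue (b i)) 0 =
      ∑ i ∈ T with 0 ≤ (D i).realVirtualValue (b i), (D i).realVirtualValue (b i) := by
    rw [Finset.sum_filter]
    refine Finset.sum_congr rfl fun i _ => ?_
    split_ifs with h
    · exact max_eq_left h
    · exact max_eq_right (not_le.1 h).le
  rw [h1, ← EReal.coe_le_coe_iff, ← sum_virtualValue_eq_coe fun i hi => hfin i (hTR (hsub hi)),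
    ← sum_virtualValue_eq_coe fun i hi => hfin i (winners_subset hi)]
  by_cases he : {i ∈ T | 0 ≤ (D i).realVirtualValue (b i)} = winners M D R b
  · rw [he]
  · rcases (isAllocation_allocation M R _).2 _
      ⟨hsub.trans hTR, hT.subset (Finset.coe_subset.2 hsub)⟩ he with h | h
    · exact h.le
    · exact h.1.le

/-! ## Credibility -/

section Credible

variable {N : Finset ℕ} {M : Matroid ℕ} {D : ℕ → ValueDist}

/-- The virtual surplus of the honest auction. -/
noncomputable def honestSurplus (N : Finset ℕ) (M : Matroid ℕ) (D : ℕ → ValueDist) (v : N → ℝ) : ℝ :=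
  ∑ i : N, ((honest N M D).winEvent N i).indicator (fun v => (D i).realVirtualValue (v i)) v

theorem integrable_honestSurplus (hD : ∀ i ∈ N, (D i).MHR) :
    Integrable (honestSurplus N M D) (valuesLaw N D) :=
  integrable_finsetSum _ fun i _ => (integrable_realVirtualValue (hD i i.2)).indicator
    (Plan.measurableSet_winEvent N i)

/-- The expected honest revenue is the expected honest virtual surplus. -/
theorem integral_honest_revenue (hM : M.E = (N : Set ℕ)) (hD : ∀ i ∈ N, (D i).MHR) (f : ℝ) :
    ∫ v, (honest N M D).revenue f v ∂(valuesLaw N D) =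
      ∫ v, honestSurplus N M D v ∂(valuesLaw N D) := by
  have h := honest_admissible hM hD
  have hN : N ⊆ N ∪ (honest N M D).fakes := Finset.subset_union_left
  have heq : (honest N M D).revenue f = fun v => ∑ i : N,
      ((honest N M D).winEvent N i).indicator ((honest N M D).price N i) v := by
    funext v
    rw [Plan.revenue_eq_revenueOf, Plan.revenueOf]
    have hR : (N ∪ (honest N M D).fakes) \ (honest N M D).conceal v = N := by simp [honest]
    have hC : ((honest N M D).conceal v).card = 0 := Finset.card_empty
    rw [hR, hC, Nat.cast_zero, mul_zero, sub_zero]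
    refine Finset.sum_congr rfl fun i _ => ?_
    rw [Set.indicator_apply]
    rfl
  rw [heq]
  exact h.integral_sum_price_eq hN hD fun _ _ => rfl

/-- The pointwise core: retained winners contribute `φ` plus their defect, newcomers at most `max φ
0`. The events in the defect sum use full revelation, hence no longer involve `conceal`. -/
theorem revenue_le_honestSurplus (hD : ∀ i ∈ N, (D i).MHR) {f : ℝ} (hf0 : 0 ≤ f)
    (hf : ∀ i ∈ N, (D i).reserve ≤ f) {π : Plan N} (h : π.Admissible M) {v : N → ℝ}
    (hv : ∀ i, 0 ≤ v i) (hfin : ∀ i : N, (D i).invHazard (v i) ≠ ⊤) :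
    π.revenue f v ≤ honestSurplus N M D v + ∑ i : N, (π.winEvent (N ∪ π.fakes) i).indicator
      (fun v => π.price (N ∪ π.fakes) i v - (D i).realVirtualValue (v i)) v := by
  classical
  have hb : ∀ i : N, (honest N M D).bids v i = v i := (honest N M D).bids_coe v
  have hE := h.coe_subset_ground (Finset.Subset.refl _)
  have hG : ∑ i : N, (if v ∈ π.winEvent (π.revealed v) i then
      max ((D i).realVirtualValue (v i)) 0 else 0) ≤ honestSurplus N M D v := by
    have hsum := sum_max_le_sum_winners (M := M) (D := D) (R := N) (b := (honest N M D).bids v)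
      (fun i hi => by
        rw [hb ⟨i, hi⟩]
        exact hfin ⟨i, hi⟩) (h.feasible v hv) Finset.inter_subset_right
    rw [Plan.realWinners, Plan.sum_realWinners,
      ← Finset.inter_eq_left.2 (winners_subset (M := M) (D := D) (R := N)
        (b := (honest N M D).bids v)), Plan.sum_realWinners] at hsum
    simp only [hb] at hsum
    refine hsum.trans_eq (Finset.sum_congr rfl fun i _ => ?_)
    rw [Set.indicator_apply]
    rfl
  refine (h.revenue_le hf0 hv).trans (le_trans ?_ (add_le_add_left hG _))
  rw [← Finset.sum_add_distrib]
  refine Finset.sum_le_sum fun i _ => ?_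
  have hsub : v ∈ π.winEvent (N ∪ π.fakes) i → v ∈ π.winEvent (π.revealed v) i := fun hw =>
    mem_winners_of_subset hE Finset.sdiff_subset (Finset.mem_sdiff.2
      ⟨Finset.mem_union_left _ i.2,
        fun hc => Finset.disjoint_left.1 h.disjoint i.2 (h.conceal_subset v hc)⟩) hw
  have hmax : v i - f ≤ max ((D i).realVirtualValue (v i)) 0 :=
    le_trans (sub_le_sub_left (hf i i.2) _) ((hD i i.2).sub_reserve_le (hfin i))
  rw [Set.indicator_apply]
  by_cases hT : v ∈ π.winEvent (π.revealed v) i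
  · by_cases hW : v ∈ π.winEvent (N ∪ π.fakes) i
    · simp only [hT, hW, if_true]
      linarith [le_max_left ((D i).realVirtualValue (v i)) 0]
    · simpa only [hT, hW, if_true, if_false, add_zero] using hmax
  · have hW : v ∉ π.winEvent (N ∪ π.fakes) i := fun hw => hT (hsub hw)
    simp [hT, hW]

theorem integral_revenue_le (hM : M.E = (N : Set ℕ)) (hD : ∀ i ∈ N, (D i).MHR) {f : ℝ}
    (hf0 : 0 ≤ f) (hf : ∀ i ∈ N, (D i).reserve ≤ f) {π : Plan N} (h : π.Admissible M) :
    ∫ v, π.revenue f v ∂(valuesLaw N D) ≤ ∫ v, (honest N M D).revenue f v ∂(valuesLaw N D) := by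
  have hR := Finset.Subset.refl (N ∪ π.fakes)
  have hW := fun i => π.measurableSet_winEvent (N ∪ π.fakes) i
  have hp := fun i : N => h.integrableOn_price hR (hD i i.2)
  have hφ := fun i : N => (integrable_realVirtualValue (hD i i.2)).integrableOn
    (s := π.winEvent (N ∪ π.fakes) i)
  have hI : ∀ i : N, Integrable ((π.winEvent (N ∪ π.fakes) i).indicator
      fun v => π.price (N ∪ π.fakes) i v - (D i).realVirtualValue (v i)) (valuesLaw N D) :=
    fun i => (integrable_indicator_iff (hW i)).2 ((hp i).sub (hφ i))
  have hnn : ∀ᵐ v ∂(valuesLaw N D), ∀ i : N, 0 ≤ v i :=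
    ae_value (p := fun _ t => 0 ≤ t) fun i => (D i).ae_nonneg
  have hfin : ∀ᵐ v ∂(valuesLaw N D), ∀ i : N, (D i).invHazard (v i) ≠ ⊤ :=
    ae_value (p := fun i t => (D i).invHazard t ≠ ⊤) fun i => (D i).ae_invHazard_ne_top
  have hG := integrable_honestSurplus (M := M) hD
  have hsum := integrable_finsetSum Finset.univ fun i _ => hI i
  calc ∫ v, π.revenue f v ∂(valuesLaw N D)
      ≤ ∫ v, (honestSurplus N M D v + ∑ i : N, (π.winEvent (N ∪ π.fakes) i).indicator
          (fun v => π.price (N ∪ π.fakes) i v - (D i).realVirtualValue (v i)) v)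
          ∂(valuesLaw N D) := by
        refine integral_mono_ae (h.integrable_revenue hD f) (hG.add hsum) ?_
        filter_upwards [hnn, hfin] with v hv hv'
        exact revenue_le_honestSurplus hD hf0 hf h hv hv'
    _ = ∫ v, honestSurplus N M D v ∂(valuesLaw N D) + ∑ i : N,
          (∫ v in π.winEvent (N ∪ π.fakes) i, π.price (N ∪ π.fakes) i v ∂(valuesLaw N D) -
          ∫ v in π.winEvent (N ∪ π.fakes) i, (D i).realVirtualValue (v i) ∂(valuesLaw N D)) := by
        rw [integral_add hG hsum, integral_finsetSum _ fun i _ => hI i]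
        congr 1
        refine Finset.sum_congr rfl fun i _ => ?_
        rw [integral_indicator (hW i), integral_sub (hp i) (hφ i)]
    _ ≤ ∫ v, honestSurplus N M D v ∂(valuesLaw N D) := by
        refine add_le_of_nonpos_right (Finset.sum_nonpos fun i _ => ?_)
        exact sub_nonpos.2 (h.setIntegral_price_le hR (hD i i.2))
    _ = _ := (integral_honest_revenue hM hD f).symm

end Credible

end DRA

theorem mainTheorem1 (N : Finset ℕ) (hN : N.Nonempty) (M : Matroid ℕ) (hM : M.E = (N : Set ℕ))
    (D : ℕ → DRA.ValueDist) (hD : ∀ i ∈ N, (D i).MHR) :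
    DRA.Credible N M D (N.sup' hN fun i => (D i).reserve) := by
  have hf : ∀ i ∈ N, (D i).reserve ≤ N.sup' hN fun i => (D i).reserve :=
    fun i hi => Finset.le_sup' (fun i => (D i).reserve) hi
  have hf0 : 0 ≤ N.sup' hN fun i => (D i).reserve :=
    (D hN.choose).reserve_nonneg.trans (hf _ hN.choose_spec)
  exact ⟨DRA.honest_admissible hM hD, fun π h =>
    ⟨h.integrable_revenue hD _, DRA.integral_revenue_le hM hD hf0 hf h⟩⟩
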